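/- Let $p$ be a prime and let $R$ be a regular domain of characteristic $p$ that is $F$-finite (i.e. the Frobenius endomorphism $R\to R$ is finite). For an ideal $\mathfrak{b}$ of a commutative ring $S$ of characteristic $p$ and $q=p^e$ with $e\ge 0$, let $\mathfrak{b}^{[q]}=\langle f^q : f\in\mathfrak{b}\rangle$. For an integer $k\ge 0$ with base $p$ expansion $k=k_0+k_1p+\cdots+k_rp^r$, let $\mathfrak{b}^{[k]}=\prod_{i=0}^{r}\big(\mathfrak{b}^{k_i}\big)^{[p^i]}$. If $S$ is an $F$-finite regular domain, let $\mathfrak{b}^{[1/q]}$ be the smallest ideal $\mathfrak{c}$ of $S$ such that $\mathfrak{b}\subseteq\mathfrak{c}^{[q]}$, and for a real number $t>0$ let \[ \mathfrak{b}^{[t]}=\bigcup_{e\ge 0}\big(\mathfrak{b}^{[\lceil p^e t\rceil]}\big)^{[1/p^e]}, \qquad \tau(\mathfrak{b}^{t})=\bigcup_{e\ge 0}\big(\mathfrak{b}^{\lceil p^e t\rceil}\big)^{[1/p^e]} \] be the $t$-th Frobenius power and the test ideal of $\mathfrak{b}$ with exponent $t$ (both unions are of ascending chains of ideals). For $f\in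 S$, write $\tau(f^t)=\tau(\langle f\rangle^t)$. Theorem (Principalization). Let $\mathfrak{a}=\langle g_1,\dots,g_m\rangle$ be an ideal of $R$, let $z=z_1,\dots,z_m$ be variables over $R$, and let $G=z_1g_1+\cdots+z_mg_m\in R[z]$ be the generic linear combination. If $0<t<1$, then \[ \tau(G^t)=\mathfrak{a}^{[t]}\cdot R[z]\qquad\text{and}\qquad \mathfrak{a}^{[t]}=\tau(G^t)\cap R . \] -/

import Mathlib

open scoped BigOperators

noncomputable section

namespace GenFrob

variable {R : Type*} [CommRing R]

/-- The standard Frobenius power `I^[q]`: the ideal generated by the `q`-th powers of the elements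
of `I` (meant for `q = p ^ e` in a ring of characteristic `p`). -/
def frobPow (q : ℕ) (I : Ideal R) : Ideal R :=
  Ideal.span {x : R | ∃ f ∈ I, x = f ^ q}

/-- The integral Frobenius power `I^[k]`. If `k = k₀ + k₁ p + k₂ p² + ⋯` is the base `p` expansion,
it is the product of the ideals `(I ^ kᵢ)^[p ^ i]`. Here `kᵢ = k / p ^ i % p`, and it suffices to
let `i` run through `0, …, k` since `k < p ^ i` for `i > k`. -/
def intFrobPow (p k : ℕ) (I : Ideal R) : Ideal R :=
  ∏ i ∈ Finset.range (k + 1), frobPow (p ^ i) (I ^ (k / p ^ i % p))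

/-- The Frobenius root `I^[1/q]`: the smallest ideal `J` with `I ≤ J^[q]`. -/
def frobRoot (q : ℕ) (I : Ideal R) : Ideal R :=
  sInf {J : Ideal R | I ≤ frobPow q J}

/-- The rational Frobenius power `I^[k / p ^ e] = (I^[k])^[1 / p ^ e]`. -/
def ratFrobPow (p k e : ℕ) (I : Ideal R) : Ideal R :=
  frobRoot (p ^ e) (intFrobPow p k I)

/-- The real Frobenius power `I^[t]`, `t ≥ 0`: the union of the ascending chain of the ideals
`I^[⌈p ^ e t⌉ / p ^ e]`, whose exponents decrease to `t`. -/
def realFrobPow (p : ℕ) (t : ℝ) (I : Ideal R) : Ideal R :=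
  ⨆ e : ℕ, ratFrobPow p ⌈(p : ℝ) ^ e * t⌉₊ e I

/-- The test ideal `τ(I ^ t)`, `t > 0`: the union of the ascending chain of the ideals
`(I ^ ⌈p ^ e t⌉)^[1 / p ^ e]`, formed with ordinary powers of `I`. -/
def testIdeal (p : ℕ) (t : ℝ) (I : Ideal R) : Ideal R :=
  ⨆ e : ℕ, frobRoot (p ^ e) (I ^ ⌈(p : ℝ) ^ e * t⌉₊)

/-- The generic linear combination `z₁ g₁ + ⋯ + z_m g_m` in `R[z₁, …, z_m]`. -/
def genericCombination {m : ℕ} (g : Fin m → R) : MvPolynomial (Fin m) R :=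
  ∑ i, MvPolynomial.X i * MvPolynomial.C (g i)

end GenFrob

end

/-! Write `q = p ^ e`, `k = ⌈q t⌉`, and let `a` be the ideal `(g₁, …, g_m)`. The two sides are
compared for each `e`, testing against every ideal competing in the infimum `frobRoot`. Upper bound:
`G ^ k` lies in the extension of `a^[k]`, so each `c` with `a^[k] ≤ c^[q]` competes after extension
to `R[z]` (`frobRoot_genericCombination_le`). Lower bound, for `k < q`: let `G ^ k ∈ J^[q]`. As `G ^
k` has degree below `q`, its coefficients are its coordinates over `R[z^q]`, so they lie in the
extension of `J` along Frobenius on coefficients. That Frobenius is flat (Kunz), so contraction to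
`R` commutes with it and the coefficients lie in `(J ∩ R)^[q]`. They generate an ideal containing
`a^[k]`: base `p` digits do not mix, and multinomial coefficients of degree below `p` are units
(`intFrobPow_le_coeffIdeal`). Hence `a^[k/q] ≤ J ∩ R` (`map_ratFrobPow_le`). The indices with `k =
q` contribute nothing new because `t < 1`. -/

/-! ### Regular local rings are domains. -/

section RegularLocal

open IsLocalRing

universe u

/-- Cutting a regular local ring by an element of `m \ m ^ 2` gives a regular local ring whose
maximal ideal has fewer generators. -/
theorem IsRegularLocalRing.quotient_span_singleton {R : Type u} [CommRing R]
    [IsRegularLocalRing R] {x : R} (hx : x ∈ maximalIdeal R) (hx2 : x ∉ maximalIdeal R ^ 2) :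
    ∃ _ : IsRegularLocalRing (R ⧸ Ideal.span {x}),
      (maximalIdeal (R ⧸ Ideal.span {x})).spanFinrank < (maximalIdeal R).spanFinrank := by
  classical
  have hle : Ideal.span {x} ≤ maximalIdeal R := (Ideal.span_singleton_le_iff_mem _).mpr hx
  have hne : Ideal.span {x} ≠ ⊤ := fun h ↦
    (maximalIdeal.isMaximal R).ne_top (top_le_iff.mp (h ▸ hle))
  have : Nontrivial (R ⧸ Ideal.span {x}) := Ideal.Quotient.nontrivial_iff.mpr hne
  have : IsLocalRing (R ⧸ Ideal.span {x}) :=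
    IsLocalRing.of_surjective' (Ideal.Quotient.mk _) Ideal.Quotient.mk_surjective
  obtain ⟨s, hcard, hs⟩ :=
    Submodule.FG.exists_span_finset_card_eq_spanFinrank (maximalIdeal R).fg_of_isNoetherianRing
  have hx' : x ∈ Submodule.span R (s : Set R) := hs ▸ hx
  obtain ⟨c, -, hc⟩ := Submodule.mem_span_finset.mp hx'
  -- If all coefficients of `x` were in the maximal ideal, `x` would lie in its square. A generator
  -- with unit coefficient is redundant modulo `x`.
  have hunit : ∃ y ∈ s, IsUnit (c y) := by
    by_contra! h
    refine hx2 (hc ▸ sum_mem fun y hy ↦ ?_)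
    rw [pow_two, smul_eq_mul]
    exact Ideal.mul_mem_mul ((mem_maximalIdeal _).mpr (h y hy))
      (hs ▸ Submodule.subset_span (Finset.mem_coe.mpr hy))
  obtain ⟨y, hy, hcy⟩ := hunit
  let mk := Ideal.Quotient.mk (Ideal.span {x})
  have hmap : maximalIdeal (R ⧸ Ideal.span {x}) =
      Ideal.span (((s.erase y).image mk : Finset _) : Set (R ⧸ Ideal.span {x})) := by
    have h1 : maximalIdeal (R ⧸ Ideal.span {x}) = (maximalIdeal R).map mk := by
      refine (IsLocalRing.eq_maximalIdeal ?_).symm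
      refine (Ideal.map_eq_top_or_isMaximal_of_surjective mk Ideal.Quotient.mk_surjective
        (maximalIdeal.isMaximal R)).resolve_left fun h ↦ ?_
      have h2 := Ideal.comap_map_of_surjective' mk Ideal.Quotient.mk_surjective (maximalIdeal R)
      rw [h, Ideal.comap_top, Ideal.mk_ker, sup_eq_left.mpr hle] at h2
      exact (maximalIdeal.isMaximal R).ne_top h2.symm
    rw [h1, ← hs, ← Ideal.span, Ideal.map_span]
    apply le_antisymm
    · rw [Ideal.span_le]
      rintro _ ⟨z, hz, rfl⟩
      by_cases hzy : z = y
      · subst hzy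
        have hmem : mk (c z * z) ∈ Ideal.span
            (((s.erase z).image mk : Finset _) : Set (R ⧸ Ideal.span {x})) := by
          have h0 : mk (∑ a ∈ s, c a • a) = 0 :=
            Ideal.Quotient.eq_zero_iff_mem.mpr (hc.symm ▸ Ideal.mem_span_singleton_self x)
          rw [← Finset.add_sum_erase _ _ hy, map_add, smul_eq_mul] at h0
          rw [eq_neg_of_add_eq_zero_left h0, map_sum]
          refine neg_mem (sum_mem fun w hw ↦ ?_)
          rw [smul_eq_mul, map_mul]
          exact Ideal.mul_mem_left _ _
            (Ideal.subset_span (Finset.mem_coe.mpr (Finset.mem_image_of_mem _ hw)))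
        rw [map_mul] at hmem
        exact (Ideal.unit_mul_mem_iff_mem _ (hcy.map mk)).mp hmem
      · exact Ideal.subset_span (Finset.mem_coe.mpr
          (Finset.mem_image_of_mem _ (Finset.mem_erase.mpr ⟨hzy, hz⟩)))
    · refine Ideal.span_mono ?_
      rw [Finset.coe_image]
      exact Set.image_mono (Finset.coe_subset.mpr (Finset.erase_subset _ _))
  have hlt : (maximalIdeal (R ⧸ Ideal.span {x})).spanFinrank + 1 ≤
      (maximalIdeal R).spanFinrank := by
    rw [hmap, ← hcard, ← Finset.card_erase_add_one hy]
    refine Nat.add_le_add_right ?_ 1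
    refine (Submodule.spanFinrank_span_le_ncard_of_finite (Finset.finite_toSet _)).trans ?_
    rw [Set.ncard_coe_finset]
    exact Finset.card_image_le
  refine ⟨IsRegularLocalRing.of_spanFinrank_maximalIdeal_le _ ?_, hlt⟩
  have hdim : ringKrullDim R ≤ ringKrullDim (R ⧸ Ideal.span {x}) + 1 := by
    refine (ringKrullDim_le_ringKrullDim_quotient_add_spanFinrank (Ideal.span {x})
      (by rwa [ringJacobson_eq_maximalIdeal])).trans ?_
    gcongr
    have := Submodule.spanFinrank_span_le_ncard_of_finite (R := R) (Set.finite_singleton x)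
    rw [Set.ncard_singleton] at this
    exact_mod_cast this
  have hreg := (isRegularLocalRing_iff R).mp ‹_›
  rw [← hreg] at hdim
  have h3 : ((maximalIdeal (R ⧸ Ideal.span {x})).spanFinrank : WithBot ℕ∞) + 1 ≤
      ringKrullDim (R ⧸ Ideal.span {x}) + 1 := le_trans (by exact_mod_cast hlt) hdim
  exact (ENat.WithBot.add_le_add_one_right_iff).mp h3

/-- Prime avoidance gives `x` outside `m ^ 2` and all minimal primes. By induction `(x)` is prime,
so it contains a minimal prime `q`; since `x ∉ q`, `q = x q`, and Nakayama gives `q = 0`. -/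
theorem IsRegularLocalRing.isDomain_of_spanFinrank (n : ℕ) :
    ∀ (R : Type u) [CommRing R] [IsRegularLocalRing R],
      (maximalIdeal R).spanFinrank = n → IsDomain R := by
  induction n using Nat.strong_induction_on with
  | _ n ih =>
  intro R _ _ hn
  have hfg := (maximalIdeal R).fg_of_isNoetherianRing
  by_cases hm : maximalIdeal R = ⊥
  · exact (isField_iff_maximalIdeal_eq.mpr hm).isDomain
  have hfin := minimalPrimes.finite_of_isNoetherianRing R
  obtain ⟨x, hxm, hx2, hxq⟩ : ∃ x ∈ maximalIdeal R, x ∉ maximalIdeal R ^ 2 ∧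
      ∀ q ∈ minimalPrimes R, x ∉ q := by
    by_contra! h
    have hsub : (maximalIdeal R : Set R) ⊆
        ⋃ i ∈ (↑(insert (maximalIdeal R ^ 2) hfin.toFinset) : Set (Ideal R)), (i : Set R) := by
      intro x hx
      simp only [Finset.coe_insert, Set.Finite.coe_toFinset, Set.mem_iUnion, Set.mem_insert_iff]
      by_cases hx2 : x ∈ maximalIdeal R ^ 2
      · exact ⟨_, Or.inl rfl, hx2⟩
      · obtain ⟨q, hq, hxq⟩ := h x hx hx2
        exact ⟨q, Or.inr hq, hxq⟩
    -- Prime avoidance tolerates up to two non-prime ideals; `m ^ 2` fills both places.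
    rw [Ideal.subset_union_prime (f := fun i : Ideal R ↦ i) (maximalIdeal R ^ 2)
      (maximalIdeal R ^ 2)] at hsub
    · obtain ⟨i, hi, hle⟩ := hsub
      rw [Finset.mem_insert, Set.Finite.mem_toFinset] at hi
      rcases hi with rfl | hi
      · refine hm (Submodule.eq_bot_of_le_smul_of_le_jacobson_bot _ _ hfg (hle.trans ?_)
          (maximalIdeal_le_jacobson _))
        rw [pow_two, smul_eq_mul]
      · have hmi : i = maximalIdeal R :=
          le_antisymm (le_maximalIdeal (hi.1.1.ne_top)) hle
        have h0 : (maximalIdeal R).height = 0 := Ideal.height_eq_zero_iff.mpr (hmi ▸ hi)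
        have hreg := (isRegularLocalRing_iff R).mp ‹_›
        rw [← maximalIdeal_height_eq_ringKrullDim, h0] at hreg
        have : (maximalIdeal R).spanFinrank = 0 := by exact_mod_cast hreg
        exact hm ((Submodule.spanFinrank_eq_zero_iff_eq_bot hfg).mp this)
    · intro i hi h1 _
      rw [Finset.mem_insert, Set.Finite.mem_toFinset] at hi
      exact (hi.resolve_left h1).1.1
  obtain ⟨_, hlt⟩ := IsRegularLocalRing.quotient_span_singleton hxm hx2
  have := ih _ (hn ▸ hlt) (R ⧸ Ideal.span {x}) rfl
  have hprime : (Ideal.span {x}).IsPrime := (Ideal.Quotient.isDomain_iff_prime _).mp this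
  obtain ⟨q, hq, hqx⟩ := Ideal.exists_minimalPrimes_le (bot_le : ⊥ ≤ Ideal.span {x})
  have hqp : q.IsPrime := hq.1.1
  have hbot : q = ⊥ := by
    refine Submodule.eq_bot_of_le_smul_of_le_jacobson_bot (Ideal.span {x}) q
      q.fg_of_isNoetherianRing (fun y hy ↦ ?_)
      (((Ideal.span_singleton_le_iff_mem _).mpr hxm).trans (maximalIdeal_le_jacobson _))
    obtain ⟨z, rfl⟩ := Ideal.mem_span_singleton'.mp (hqx hy)
    rw [mul_comm, smul_eq_mul]
    exact Ideal.mul_mem_mul (Ideal.mem_span_singleton_self x)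
      ((hqp.mem_or_mem hy).resolve_right (hxq q hq))
  exact IsDomain.of_bot_isPrime R (hbp := hbot ▸ hqp)

instance IsRegularLocalRing.isDomain (R : Type u) [CommRing R] [IsRegularLocalRing R] :
    IsDomain R :=
  IsRegularLocalRing.isDomain_of_spanFinrank _ R rfl

end RegularLocal

/-! ### Flatness of Frobenius on an `F`-finite regular ring. -/

section Kunz

open IsLocalRing
open scoped Pointwise

universe u

theorem Module.Free.of_exact {A N₁ N₂ N₃ : Type*} [CommRing A] [AddCommGroup N₁] [AddCommGroup N₂]
    [AddCommGroup N₃] [Module A N₁] [Module A N₂] [Module A N₃] [Module.Free A N₁]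
    [Module.Free A N₃] (f : N₁ →ₗ[A] N₂) (g : N₂ →ₗ[A] N₃) (hf : Function.Injective f)
    (hfg : Function.Exact f g) (hg : Function.Surjective g) : Module.Free A N₂ := by
  obtain ⟨l, hl⟩ := Module.projective_lifting_property g LinearMap.id hg
  exact Module.Free.of_equiv ((hfg.splitSurjectiveEquiv hf) ⟨l, hl⟩).1.symm

/-- The ring homomorphism `R / x → S / y ^ i` induced by `f : R → S` when `f x = y ^ n`
and `i ≤ n`. -/
def quotientSpanPowMap {R S : Type*} [CommRing R] [CommRing S] (f : R →+* S) {x : R} {y : S}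
    {n : ℕ} (hxy : f x = y ^ n) (i : ℕ) (hi : i ≤ n) :
    R ⧸ Ideal.span {x} →+* S ⧸ Ideal.span {y ^ i} :=
  Ideal.quotientMap _ f <| by
    rw [Ideal.span_singleton_le_iff_mem, Ideal.mem_comap, hxy, Ideal.mem_span_singleton]
    exact pow_dvd_pow y hi

/-- Induction along `0 → S/y^i → S/y^(i+1) → S/y → 0`, with first map multiplication by `y`. The
case `i = n` is `S / xS`. -/
theorem free_quotientSpanPowMap {R S : Type*} [CommRing R] [CommRing S] (f : R →+* S) {x : R}
    {y : S} {n : ℕ} (hxy : f x = y ^ n) (hy : y ∈ nonZeroDivisors S) (hn : 1 ≤ n)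
    (h1 : letI := (quotientSpanPowMap f hxy 1 hn).toAlgebra
      Module.Free (R ⧸ Ideal.span {x}) (S ⧸ Ideal.span {y ^ 1})) (i : ℕ) :
    ∀ hi : i ≤ n, letI := (quotientSpanPowMap f hxy i hi).toAlgebra
      Module.Free (R ⧸ Ideal.span {x}) (S ⧸ Ideal.span {y ^ i}) := by
  induction i with
  | zero =>
    intro hi
    let := (quotientSpanPowMap f hxy 0 hi).toAlgebra
    have : Subsingleton (S ⧸ Ideal.span {y ^ 0}) := by
      rw [Ideal.Quotient.subsingleton_iff, pow_zero, Ideal.span_singleton_one]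
    exact Module.Free.of_subsingleton _ _
  | succ i ih =>
    intro hi
    have hi' : i ≤ n := (Nat.le_succ i).trans hi
    let := (quotientSpanPowMap f hxy 1 hn).toAlgebra
    let := (quotientSpanPowMap f hxy i hi').toAlgebra
    let := (quotientSpanPowMap f hxy (i + 1) hi).toAlgebra
    have := ih hi'
    have hle : Ideal.span {y ^ (i + 1)} ≤ Ideal.span {y ^ 1} :=
      Ideal.span_singleton_le_span_singleton.mpr (pow_dvd_pow y (Nat.le_add_left 1 i))
    have hmul : Ideal.span {y ^ i} ≤
        Submodule.comap (LinearMap.mulLeft S y) (Ideal.span {y ^ (i + 1)}) := by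
      rw [Ideal.span_singleton_le_iff_mem, Submodule.mem_comap, LinearMap.mulLeft_apply, ← pow_succ']
      exact Ideal.mem_span_singleton_self _
    let a₀ : (S ⧸ Ideal.span {y ^ i}) →ₗ[S] S ⧸ Ideal.span {y ^ (i + 1)} :=
      Submodule.mapQ _ _ (LinearMap.mulLeft S y) hmul
    have ha₀ (s : S) : a₀ (Ideal.Quotient.mk _ s) = Ideal.Quotient.mk _ (y * s) := rfl
    let b₀ : S ⧸ Ideal.span {y ^ (i + 1)} →+* S ⧸ Ideal.span {y ^ 1} := Ideal.Quotient.factor hle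
    have hb₀ (s : S) : b₀ (Ideal.Quotient.mk _ s) = Ideal.Quotient.mk _ s := rfl
    let a : (S ⧸ Ideal.span {y ^ i}) →ₗ[R ⧸ Ideal.span {x}] S ⧸ Ideal.span {y ^ (i + 1)} :=
      { toFun := a₀
        map_add' := a₀.map_add
        map_smul' := by
          intro r s
          obtain ⟨r, rfl⟩ := Ideal.Quotient.mk_surjective r
          obtain ⟨s, rfl⟩ := Ideal.Quotient.mk_surjective s
          change a₀ (Ideal.Quotient.mk _ (f r * s)) =
            Ideal.Quotient.mk _ (f r) * a₀ (Ideal.Quotient.mk _ s)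
          rw [ha₀, ha₀, ← map_mul, mul_left_comm] }
    let b : (S ⧸ Ideal.span {y ^ (i + 1)}) →ₗ[R ⧸ Ideal.span {x}] S ⧸ Ideal.span {y ^ 1} :=
      { toFun := b₀
        map_add' := b₀.map_add
        map_smul' := by
          intro r s
          obtain ⟨r, rfl⟩ := Ideal.Quotient.mk_surjective r
          obtain ⟨s, rfl⟩ := Ideal.Quotient.mk_surjective s
          rfl }
    refine Module.Free.of_exact a b ?_ ?_ ?_
    · rw [injective_iff_map_eq_zero]
      intro s hs
      obtain ⟨s, rfl⟩ := Ideal.Quotient.mk_surjective s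
      replace hs : Ideal.Quotient.mk (Ideal.span {y ^ (i + 1)}) (y * s) = 0 := hs
      rw [Ideal.Quotient.eq_zero_iff_mem, Ideal.mem_span_singleton] at hs ⊢
      obtain ⟨c, hc⟩ := hs
      refine ⟨c, mul_cancel_left_mem_nonZeroDivisors hy |>.mp ?_⟩
      rw [hc, pow_succ', mul_assoc]
    · intro s
      obtain ⟨s, rfl⟩ := Ideal.Quotient.mk_surjective s
      change Ideal.Quotient.mk (Ideal.span {y ^ 1}) s = 0 ↔ _
      rw [Ideal.Quotient.eq_zero_iff_mem, Ideal.mem_span_singleton, pow_one]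
      constructor
      · rintro ⟨c, rfl⟩
        exact ⟨Ideal.Quotient.mk _ c, rfl⟩
      · rintro ⟨c, hc⟩
        obtain ⟨c, rfl⟩ := Ideal.Quotient.mk_surjective c
        replace hc : Ideal.Quotient.mk (Ideal.span {y ^ (i + 1)}) (y * c) =
          Ideal.Quotient.mk _ s := hc
        rw [Ideal.Quotient.eq, Ideal.mem_span_singleton] at hc
        have := (dvd_pow_self y (Nat.succ_ne_zero i)).trans hc
        exact (dvd_sub_right (dvd_mul_right y c)).mp this
    · exact Ideal.Quotient.factor_surjective hle

/-- A local criterion for flatness along `f x = y ^ n`: if `S / y` is flat over `R / x`,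
then `S` is flat over `R`. -/
theorem RingHom.Flat.of_quotient_span_pow {R S : Type*} [CommRing R] [CommRing S] [IsLocalRing R]
    [IsNoetherianRing R] {f : R →+* S} (hf : f.Finite) {x : R} (hx : x ∈ maximalIdeal R) {y : S}
    {n : ℕ} (hxy : f x = y ^ n) (hy : y ∈ nonZeroDivisors S) (hn : 1 ≤ n)
    (h1 : (quotientSpanPowMap f hxy 1 hn).Flat) : f.Flat := by
  algebraize [f]
  have hne : Ideal.span {x} ≠ ⊤ := fun h ↦ (maximalIdeal.isMaximal R).ne_top
    (top_le_iff.mp (h ▸ (Ideal.span_singleton_le_iff_mem _).mpr hx))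
  have : Nontrivial (R ⧸ Ideal.span {x}) := Ideal.Quotient.nontrivial_iff.mpr hne
  have : IsLocalRing (R ⧸ Ideal.span {x}) :=
    IsLocalRing.of_surjective' (Ideal.Quotient.mk _) Ideal.Quotient.mk_surjective
  have key := free_quotientSpanPowMap f hxy hy hn (by
    let := (quotientSpanPowMap f hxy 1 hn).toAlgebra
    have : Module.Flat (R ⧸ Ideal.span {x}) (S ⧸ Ideal.span {y ^ 1}) := h1
    have hfin : (quotientSpanPowMap f hxy 1 hn).Finite := by
      refine RingHom.Finite.of_comp_finite (f := Ideal.Quotient.mk (Ideal.span {x})) ?_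
      exact (RingHom.Finite.of_surjective _
        (Ideal.Quotient.mk_surjective (I := Ideal.span {y ^ 1}))).comp hf
    have : Module.Finite (R ⧸ Ideal.span {x}) (S ⧸ Ideal.span {y ^ 1}) := hfin
    exact Module.free_of_flat_of_isLocalRing) n le_rfl
  let := (quotientSpanPowMap f hxy n le_rfl).toAlgebra
  have : IsScalarTower R (R ⧸ Ideal.span {x}) (S ⧸ Ideal.span {y ^ n}) :=
    IsScalarTower.of_algebraMap_eq fun _ ↦ rfl
  have heq : x • (⊤ : Submodule R S) = (Ideal.span {y ^ n}).restrictScalars R := by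
    ext s
    rw [Submodule.mem_smul_pointwise_iff_exists, Submodule.restrictScalars_mem,
      Ideal.mem_span_singleton]
    simp only [Submodule.mem_top, true_and, Algebra.smul_def, dvd_def, eq_comm]
    rw [show algebraMap R S x = y ^ n from hxy]
  let e : QuotSMulTop x S ≃ₗ[R] S ⧸ Ideal.span {y ^ n} :=
    (Submodule.quotEquivOfEq _ _ heq).trans
      (Submodule.Quotient.restrictScalarsEquiv R (Ideal.span {y ^ n}))
  have : Module.Free (R ⧸ Ideal.span {x}) (QuotSMulTop x S) :=
    Module.Free.of_equiv (e.extendScalarsOfSurjective Ideal.Quotient.mk_surjective).symm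
  have : Module.FinitePresentation R S := Module.finitePresentation_of_finite R S
  have hreg : IsSMulRegular S x := by
    intro s t hst
    simp only [Algebra.smul_def] at hst
    rw [show algebraMap R S x = y ^ n from hxy] at hst
    exact mul_cancel_left_mem_nonZeroDivisors (pow_mem hy n) |>.mp hst
  -- Freeness lifts from `S / xS` over `R / x` because `x` is regular on `S` and lies in the
  -- Jacobson radical.
  have := (Module.free_quotSMulTop_iff_free R S
    (maximalIdeal_le_jacobson ⊥ hx) hreg).mp inferInstance
  change Module.Flat R S
  infer_instance

theorem charP_of_ringHom {R S : Type*} [CommRing R] [CommRing S] [Nontrivial S] (f : R →+* S)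
    (p : ℕ) [hp : Fact p.Prime] [CharP R p] : CharP S p := by
  have h0 : (p : S) = 0 := by rw [← map_natCast f, CharP.cast_eq_zero, map_zero]
  have hd : ringChar S ∣ p := ringChar.dvd h0
  rcases (Nat.dvd_prime hp.out).mp hd with h | h
  · exact absurd h (CharP.ringChar_ne_one)
  · exact ringChar.of_eq h

theorem frobenius_finite_of_surjective {R S : Type*} [CommRing R] [CommRing S] (f : R →+* S)
    (hf : Function.Surjective f) (p : ℕ) [ExpChar R p] [ExpChar S p] (h : (frobenius R p).Finite) :
    (frobenius S p).Finite := by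
  refine RingHom.Finite.of_comp_finite (f := f) ?_
  rw [← RingHom.frobenius_comm]
  exact (RingHom.Finite.of_surjective f hf).comp h

/-- Induction on the embedding dimension: Frobenius sends `x` to `x ^ p`, so the criterion applies
with `y = x` and `n = p`, and reduces to Frobenius on `R / x`. -/
theorem IsRegularLocalRing.frobenius_flat_of_spanFinrank (p : ℕ) [Fact p.Prime] (n : ℕ) :
    ∀ (R : Type u) [CommRing R] [IsRegularLocalRing R] [CharP R p], (frobenius R p).Finite →
      (maximalIdeal R).spanFinrank = n → (frobenius R p).Flat := by
  induction n using Nat.strong_induction_on with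
  | _ n ih =>
  intro R _ _ _ hF hn
  have hfg := (maximalIdeal R).fg_of_isNoetherianRing
  by_cases hm : maximalIdeal R = ⊥
  · exact RingHom.Flat.of_isField (isField_iff_maximalIdeal_eq.mpr hm) _
  obtain ⟨x, hxm, hx2⟩ : ∃ x ∈ maximalIdeal R, x ∉ maximalIdeal R ^ 2 := by
    by_contra! h
    refine hm (Submodule.eq_bot_of_le_smul_of_le_jacobson_bot _ _ hfg (fun y hy ↦ ?_)
      (maximalIdeal_le_jacobson _))
    rw [smul_eq_mul, ← pow_two]
    exact h y hy
  obtain ⟨_, hlt⟩ := IsRegularLocalRing.quotient_span_singleton hxm hx2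
  have : CharP (R ⧸ Ideal.span {x}) p := charP_of_ringHom (Ideal.Quotient.mk _) p
  have hflat := ih _ (hn ▸ hlt) (R ⧸ Ideal.span {x})
    (frobenius_finite_of_surjective (Ideal.Quotient.mk _) Ideal.Quotient.mk_surjective p hF) rfl
  have hx0 : x ≠ 0 := fun h ↦ hx2 (h ▸ zero_mem _)
  refine RingHom.Flat.of_quotient_span_pow hF hxm (y := x) (n := p) rfl
    (mem_nonZeroDivisors_of_ne_zero hx0) (Fact.out : p.Prime).one_le ?_
  have hI : Ideal.span {x} = Ideal.span {x ^ 1} := by rw [pow_one]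
  have hcomp : quotientSpanPowMap (frobenius R p) (x := x) (y := x) (n := p) rfl 1
      (Fact.out : p.Prime).one_le =
      (Ideal.quotEquivOfEq hI).toRingHom.comp (frobenius (R ⧸ Ideal.span {x}) p) := by
    ext r
    rfl
  rw [hcomp]
  exact hflat.comp (RingHom.Flat.of_bijective (Ideal.quotEquivOfEq hI).bijective)

theorem RingHom.finite_iff_exists_fin {R S : Type*} [CommRing R] [CommRing S] (f : R →+* S) :
    f.Finite ↔ ∃ (n : ℕ) (s : Fin n → S), ∀ y, ∃ c : Fin n → R, ∑ i, f (c i) * s i = y := by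
  algebraize_only [f]
  change Module.Finite R S ↔ _
  rw [Module.finite_def, Submodule.fg_iff_exists_fin_generating_family]
  refine exists_congr fun n ↦ exists_congr fun s ↦ ?_
  rw [Submodule.eq_top_iff']
  refine forall_congr' fun y ↦ ?_
  rw [Submodule.mem_span_range_iff_exists_fun]
  rfl

theorem frobenius_finite_of_isLocalization {R S : Type*} [CommRing R] [CommRing S] [Algebra R S]
    (M : Submonoid R) [IsLocalization M S] (p : ℕ) [hp : Fact p.Prime] [CharP R p] [CharP S p]
    (h : (frobenius R p).Finite) : (frobenius S p).Finite := by
  rw [RingHom.finite_iff_exists_fin] at h ⊢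
  obtain ⟨n, s, hs⟩ := h
  refine ⟨n, fun i ↦ algebraMap R S (s i), fun y ↦ ?_⟩
  obtain ⟨a, u, rfl⟩ := IsLocalization.exists_mk'_eq M y
  -- `a / u = a u^(p-1) / u^p`, whose denominator is a `p`-th power.
  obtain ⟨c, hc⟩ := hs (a * u ^ (p - 1))
  refine ⟨fun i ↦ IsLocalization.mk' S (c i) u, ?_⟩
  have hu := IsLocalization.map_units S u
  refine (hu.pow p).mul_left_cancel ?_
  rw [Finset.mul_sum]
  have h1 : ∀ i, algebraMap R S u ^ p * (frobenius S p (IsLocalization.mk' S (c i) u) *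
      algebraMap R S (s i)) = algebraMap R S (frobenius R p (c i) * s i) := by
    intro i
    rw [frobenius_def, ← mul_assoc, ← mul_pow, IsLocalization.mk'_spec', map_mul, frobenius_def,
      map_pow]
  rw [Finset.sum_congr rfl fun i _ ↦ h1 i, ← map_sum, hc, ← Nat.sub_add_cancel hp.out.one_le,
    pow_succ, mul_assoc, IsLocalization.mk'_spec', Nat.add_sub_cancel, map_mul, map_pow, mul_comm]

/-- The easy half of Kunz's theorem in the `F`-finite case: the Frobenius endomorphism of a
regular ring is flat. -/
theorem IsRegularRing.frobenius_flat (R : Type u) [CommRing R] [IsRegularRing R] (p : ℕ)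
    [Fact p.Prime] [CharP R p] (hF : (frobenius R p).Finite) : (frobenius R p).Flat := by
  refine RingHom.Flat.ofLocalizationPrime _ fun J hJ ↦ ?_
  have hJc : J.comap (frobenius R p) = J := by
    ext a
    rw [Ideal.mem_comap, frobenius_def]
    exact ⟨hJ.mem_of_pow_mem p, fun h ↦ J.pow_mem_of_mem h p (Fact.out : p.Prime).pos⟩
  suffices H : ∀ (Q : Ideal R) [Q.IsPrime] (hQ : Q = J.comap (frobenius R p)),
      (Localization.localRingHom Q J (frobenius R p) hQ).Flat from H _ rfl
  intro Q _ hQ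
  obtain rfl : Q = J := hQ.trans hJc
  have : CharP (Localization.AtPrime Q) p :=
    charP_of_ringHom (algebraMap R (Localization.AtPrime Q)) p
  have heq : Localization.localRingHom Q Q (frobenius R p) hQ =
      frobenius (Localization.AtPrime Q) p :=
    Localization.localRingHom_unique _ _ _ _ fun a ↦ by
      rw [frobenius_def, frobenius_def, map_pow]
  rw [heq]
  exact IsRegularLocalRing.frobenius_flat_of_spanFinrank p _ _
    (frobenius_finite_of_isLocalization Q.primeCompl p hF) rfl

theorem IsRegularRing.iterateFrobenius_flat (R : Type u) [CommRing R] [IsRegularRing R] (p : ℕ)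
    [Fact p.Prime] [CharP R p] (hF : (frobenius R p).Finite) (e : ℕ) :
    (iterateFrobenius R p e).Flat := by
  induction e with
  | zero =>
    rw [iterateFrobenius_zero]
    exact RingHom.Flat.id R
  | succ e ih =>
    rw [iterateFrobenius_add, iterateFrobenius_one]
    exact (IsRegularRing.frobenius_flat R p hF).comp ih

end Kunz

/-! ### Contraction of ideals along flat maps. -/

section Contraction

open TensorProduct

/-- Along a faithfully flat homomorphism, extended ideals compare as the original ones. -/
theorem RingHom.FaithfullyFlat.le_of_map_le_map {R S : Type*} [CommRing R] [CommRing S]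
    {f : R →+* S} (hf : f.FaithfullyFlat) {I J : Ideal R} (h : I.map f ≤ J.map f) : I ≤ J := by
  algebraize_only [f]
  have : Module.FaithfullyFlat R S := hf
  have h1 : (J.map f).comap f = J := Ideal.comap_map_eq_self_of_faithfullyFlat (B := S) J
  exact h1 ▸ Ideal.map_le_iff_le_comap.mp h

/-- With `c` the kernel of `R → Q`, flatness embeds `S ⊗ R/c` in `S ⊗ Q`, and `S ⊗ R/c` maps to `S /
cS`. -/
theorem Module.Flat.mem_map_ker_of_tmul_eq_zero {R S Q : Type*} [CommRing R] [CommRing S]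
    [CommRing Q] [Algebra R S] [Algebra R Q] [Module.Flat R S] {s : S}
    (hs : s ⊗ₜ[R] (1 : Q) = 0) : s ∈ (RingHom.ker (algebraMap R Q)).map (algebraMap R S) := by
  let c := RingHom.ker (algebraMap R Q)
  let ι : (R ⧸ c) →ₐ[R] Q := Ideal.Quotient.liftₐ c (Algebra.ofId R Q) fun _ h ↦ h
  have hι : Function.Injective ι.toLinearMap := RingHom.kerLift_injective (algebraMap R Q)
  have hinj := Module.Flat.lTensor_preserves_injective_linearMap (M := S) ι.toLinearMap hι
  have h1 : s ⊗ₜ[R] (1 : R ⧸ c) = 0 := by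
    apply hinj
    rw [LinearMap.lTensor_tmul, map_zero, AlgHom.toLinearMap_apply, map_one, hs]
  let Ψ : S ⊗[R] (R ⧸ c) →ₐ[R] S ⧸ c.map (algebraMap R S) :=
    Algebra.TensorProduct.lift (Ideal.Quotient.mkₐ R (c.map (algebraMap R S)))
      (Ideal.quotientMapₐ (c.map (algebraMap R S)) (Algebra.ofId R S) Ideal.le_comap_map)
      fun _ _ ↦ Commute.all _ _
  have h2 := congr(Ψ $h1)
  rw [Algebra.TensorProduct.lift_tmul, map_one, mul_one, map_zero] at h2
  exact Ideal.Quotient.eq_zero_iff_mem.mp h2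

/-- Contraction of ideals to the coefficient ring commutes with flat extension of the
coefficients. -/
theorem RingHom.Flat.mem_map_comap_C {R S σ : Type*} [CommRing R] [CommRing S] {f : R →+* S}
    (hf : f.Flat) (J : Ideal (MvPolynomial σ R)) {s : S}
    (hs : MvPolynomial.C s ∈ J.map (MvPolynomial.map f)) :
    s ∈ (J.comap MvPolynomial.C).map f := by
  algebraize [f]
  -- The kernel of `R → Q` is the contraction of `J`, and `S[z] → S ⊗ Q` kills the extension of `J`.
  let Q := MvPolynomial σ R ⧸ J
  let Φ : MvPolynomial σ S →ₐ[S] S ⊗[R] Q :=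
    MvPolynomial.aeval fun i ↦ (1 : S) ⊗ₜ[R] Ideal.Quotient.mk J (MvPolynomial.X i)
  have hΦ (j : MvPolynomial σ R) : Φ (MvPolynomial.map f j) = (1 : S) ⊗ₜ[R] Ideal.Quotient.mk J j := by
    have h : Φ.toRingHom.comp (MvPolynomial.map f) =
        (Algebra.TensorProduct.includeRight : Q →ₐ[R] S ⊗[R] Q).toRingHom.comp
          (Ideal.Quotient.mk J) := by
      ext r
      · simp only [RingHom.comp_apply, MvPolynomial.map_C, RingHom.coe_coe, AlgHom.toRingHom_eq_coe,
          Algebra.TensorProduct.includeRight_apply, Φ, MvPolynomial.aeval_C]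
        rw [Algebra.TensorProduct.algebraMap_apply]
        change (algebraMap R S r) ⊗ₜ[R] (1 : Q) = 1 ⊗ₜ[R] (algebraMap R Q r)
        rw [Algebra.algebraMap_eq_smul_one, Algebra.algebraMap_eq_smul_one, smul_tmul]
      · simp [Φ]
    exact congr($h j)
  have hker : J.map (MvPolynomial.map f) ≤ RingHom.ker Φ := by
    rw [Ideal.map_le_iff_le_comap]
    intro j hj
    rw [Ideal.mem_comap, RingHom.mem_ker, hΦ,
      Ideal.Quotient.eq_zero_iff_mem.mpr hj, tmul_zero]
  have h0 : s ⊗ₜ[R] (1 : Q) = 0 := by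
    have := RingHom.mem_ker.mp (hker hs)
    rwa [MvPolynomial.aeval_C, Algebra.TensorProduct.algebraMap_apply] at this
  refine Ideal.map_mono (fun r hr ↦ ?_) (Module.Flat.mem_map_ker_of_tmul_eq_zero h0)
  have hr0 : Ideal.Quotient.mk J (MvPolynomial.C r) = 0 := hr
  exact Ideal.mem_comap.mpr (Ideal.Quotient.eq_zero_iff_mem.mp hr0)

end Contraction

/-! ### Polynomials as a free module over polynomials in `z^q`. -/

namespace MvPolynomial

variable {R σ : Type*} [CommRing R]

theorem injective_add_smul (u : σ →₀ ℕ) {q : ℕ} (hq : q ≠ 0) :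
    Function.Injective fun v : σ →₀ ℕ ↦ u + q • v :=
  fun _ _ h ↦ nsmul_right_injective hq (add_left_cancel h)

/-- The polynomial whose coefficient at `v` is the coefficient of `f` at `u + q v`. -/
noncomputable def residuePart (q : ℕ) (hq : q ≠ 0) (u : σ →₀ ℕ) (f : MvPolynomial σ R) :
    MvPolynomial σ R :=
  AddMonoidAlgebra.ofCoeff
    (Finsupp.comapDomain (fun v ↦ u + q • v) (AddMonoidAlgebra.coeff f) (injective_add_smul u hq).injOn)

variable {q : ℕ} (hq : q ≠ 0) {u : σ →₀ ℕ}

@[simp]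
theorem coeff_residuePart (f : MvPolynomial σ R) (v : σ →₀ ℕ) :
    coeff v (residuePart q hq u f) = coeff (u + q • v) f := rfl

theorem residuePart_add (f g : MvPolynomial σ R) :
    residuePart q hq u (f + g) = residuePart q hq u f + residuePart q hq u g := by
  ext v
  simp

theorem residuePart_zero : residuePart q hq u (0 : MvPolynomial σ R) = 0 := by
  ext v
  simp

/-- The monomials `z^u` with all `u i < q` form a basis over `R[z^q]`, and `residuePart` is the
coordinate at `z^u`. -/
theorem residuePart_expand_mul (hu : ∀ i, u i < q) (h f : MvPolynomial σ R) :
    residuePart q hq u (expand q h * f) = h * residuePart q hq u f := by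
  classical
  induction h using induction_on' with
  | monomial v b =>
    ext w
    rw [coeff_residuePart, expand_monomial, coeff_monomial_mul', coeff_monomial_mul',
      coeff_residuePart]
    have hle : q • v ≤ u + q • w ↔ v ≤ w := by
      rw [Finsupp.le_def, Finsupp.le_def]
      refine forall_congr' fun i ↦ ?_
      simp only [Finsupp.smul_apply, Finsupp.add_apply, smul_eq_mul]
      constructor
      · intro h
        by_contra! hlt
        have h1 : q * (w i + 1) ≤ q * v i := Nat.mul_le_mul_left q hlt
        have h2 := hu i
        rw [mul_add, mul_one] at h1
        omega
      · intro h
        exact (Nat.mul_le_mul_left q h).trans (Nat.le_add_left _ _)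
    simp only [hle]
    split_ifs with hvw
    · congr 2
      obtain ⟨d, rfl⟩ := exists_add_of_le hvw
      rw [smul_add, add_tsub_cancel_left, add_left_comm, add_tsub_cancel_left]
    · rfl
  | add h₁ h₂ ih₁ ih₂ =>
    rw [map_add, add_mul, residuePart_add, ih₁, ih₂, add_mul]

theorem lt_of_totalDegree_lt {f : MvPolynomial σ R} (hf : f.totalDegree < q) {u : σ →₀ ℕ}
    (hu : coeff u f ≠ 0) (i : σ) : u i < q := by
  have h1 := le_totalDegree (mem_support_iff.mpr hu)
  have h2 : u i ≤ u.sum fun _ e ↦ e := by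
    by_cases hi : u i = 0
    · rw [hi]
      exact Nat.zero_le _
    · exact Finset.single_le_sum (f := fun i ↦ u i) (fun _ _ ↦ Nat.zero_le _)
        (Finsupp.mem_support_iff.mpr hi)
  omega

theorem residuePart_eq_C {f : MvPolynomial σ R} (hf : f.totalDegree < q) (u : σ →₀ ℕ) :
    residuePart q hq u f = C (coeff u f) := by
  classical
  ext v
  rw [coeff_residuePart, coeff_C]
  split_ifs with hv
  · rw [← hv, smul_zero, add_zero]
  · by_contra h
    refine hv (Finsupp.ext fun i ↦ ?_)
    have := lt_of_totalDegree_lt hf h i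
    rw [Finsupp.add_apply, Finsupp.smul_apply, smul_eq_mul] at this
    by_contra hi
    rw [Finsupp.zero_apply] at hi
    have : q * 1 ≤ q * v i := Nat.mul_le_mul_left q (Nat.pos_of_ne_zero fun h ↦ hi h.symm)
    omega

variable {p : ℕ} [ExpChar R p]

theorem pow_char_pow_eq_expand_map (f : MvPolynomial σ R) (e : ℕ) :
    f ^ p ^ e = expand (p ^ e) (map (iterateFrobenius R p e) f) := by
  rw [← map_expand, map_iterateFrobenius_expand]

theorem C_coeff_mem_of_mem_map_iterateFrobenius (e : ℕ) {J : Ideal (MvPolynomial σ R)}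
    {h : MvPolynomial σ R} (hdeg : h.totalDegree < p ^ e)
    (hJ : h ∈ J.map (iterateFrobenius (MvPolynomial σ R) p e)) (u : σ →₀ ℕ) :
    C (coeff u h) ∈ J.map (map (iterateFrobenius R p e)) := by
  have hq : p ^ e ≠ 0 := by omega
  by_cases hu0 : coeff u h = 0
  · rw [hu0, C_0]
    exact zero_mem _
  have hu := lt_of_totalDegree_lt hdeg hu0
  rw [← residuePart_eq_C hq hdeg u]
  clear hdeg hu0
  -- The multiplier `a` absorbs scalars in the span induction, as `residuePart` is not linear over
  -- all of `R[z]`.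
  suffices H : ∀ a, residuePart (p ^ e) hq u (a * h) ∈ J.map (map (iterateFrobenius R p e)) by
    simpa using H 1
  refine Submodule.span_induction ?_ ?_ ?_ ?_ hJ
  · rintro _ ⟨f, hf, rfl⟩ a
    rw [iterateFrobenius_def, pow_char_pow_eq_expand_map, mul_comm, residuePart_expand_mul hq hu]
    exact Ideal.mul_mem_right _ _ (Ideal.mem_map_of_mem _ hf)
  · intro a
    rw [mul_zero, residuePart_zero]
    exact zero_mem _
  · intro x y _ _ hx hy a
    rw [mul_add, residuePart_add]
    exact add_mem (hx a) (hy a)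
  · intro b x _ hx a
    rw [smul_eq_mul, ← mul_assoc]
    exact hx _

theorem coeff_add_smul_mul_pow (e : ℕ) {h : MvPolynomial σ R} (hdeg : h.totalDegree < p ^ e)
    (h' : MvPolynomial σ R) {u : σ →₀ ℕ} (hu : ∀ i, u i < p ^ e) (v : σ →₀ ℕ) :
    coeff (u + p ^ e • v) (h * h' ^ p ^ e) = coeff u h * coeff v h' ^ p ^ e := by
  have hq : p ^ e ≠ 0 := by omega
  rw [← coeff_residuePart hq, mul_comm, pow_char_pow_eq_expand_map, residuePart_expand_mul hq hu,
    residuePart_eq_C hq hdeg, mul_comm, coeff_C_mul, coeff_map,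
    iterateFrobenius_def]

/-- The ideal generated by the coefficients of a polynomial. -/
def coeffIdeal (f : MvPolynomial σ R) : Ideal R :=
  Ideal.span (Set.range fun u ↦ coeff u f)

theorem coeff_mem_coeffIdeal (f : MvPolynomial σ R) (u : σ →₀ ℕ) : coeff u f ∈ coeffIdeal f :=
  Ideal.subset_span ⟨u, rfl⟩

/-- An exponent `u + p^e v` with all `u i < p^e` determines `u` and `v`, so no products are summed:
each is itself a coefficient. -/
theorem coeffIdeal_mul_map_le (e : ℕ) {h : MvPolynomial σ R} (hdeg : h.totalDegree < p ^ e)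
    (h' : MvPolynomial σ R) :
    coeffIdeal h * (coeffIdeal h').map (iterateFrobenius R p e) ≤ coeffIdeal (h * h' ^ p ^ e) := by
  rw [coeffIdeal, coeffIdeal, Ideal.map_span, Ideal.span_mul_span', Ideal.span_le]
  rintro _ ⟨_, ⟨u, rfl⟩, _, ⟨_, ⟨v, rfl⟩, rfl⟩, rfl⟩
  by_cases hu0 : coeff u h = 0
  · simp [hu0]
  · have := coeff_add_smul_mul_pow e hdeg h' (lt_of_totalDegree_lt hdeg hu0) v
    simp only [iterateFrobenius_def, ← this]
    exact coeff_mem_coeffIdeal _ _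

end MvPolynomial

/-! ### Frobenius powers and roots. -/

namespace GenFrob

open MvPolynomial

variable {R S : Type*} [CommRing R] [CommRing S]

theorem frobPow_pow_eq_map (p : ℕ) [ExpChar R p] (e : ℕ) (I : Ideal R) :
    frobPow (p ^ e) I = I.map (iterateFrobenius R p e) := by
  rw [frobPow, Ideal.map]
  congr 1
  ext x
  simp only [Set.mem_ofPred_eq, Set.mem_image, SetLike.mem_coe, iterateFrobenius_def, eq_comm]

theorem map_frobPow_le (f : R →+* S) (q : ℕ) (I : Ideal R) :
    (frobPow q I).map f ≤ frobPow q (I.map f) := by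
  rw [frobPow, Ideal.map_span, Ideal.span_le]
  rintro _ ⟨_, ⟨x, hx, rfl⟩, rfl⟩
  exact Ideal.subset_span ⟨f x, Ideal.mem_map_of_mem f hx, map_pow f x q⟩

theorem pow_mem_frobPow {q : ℕ} {I : Ideal R} {x : R} (hx : x ∈ I) : x ^ q ∈ frobPow q I :=
  Ideal.subset_span ⟨x, hx, rfl⟩

theorem frobRoot_le {q : ℕ} {I J : Ideal R} (h : I ≤ frobPow q J) : frobRoot q I ≤ J :=
  sInf_le h

theorem map_intFrobPow (f : R →+* S) (p : ℕ) [ExpChar R p] [ExpChar S p] (k : ℕ) (I : Ideal R) :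
    (intFrobPow p k I).map f = intFrobPow p k (I.map f) := by
  rw [intFrobPow, intFrobPow, ← Ideal.mapHom_apply, map_prod]
  refine Finset.prod_congr rfl fun i _ ↦ ?_
  rw [Ideal.mapHom_apply, frobPow_pow_eq_map, frobPow_pow_eq_map, ← Ideal.map_pow, Ideal.map_map,
    Ideal.map_map, RingHom.iterateFrobenius_comm]

theorem pow_mod_mem_prod (p : ℕ) {I : Ideal R} {x : R} (hx : x ∈ I) (k N : ℕ) :
    x ^ (k % p ^ N) ∈ ∏ i ∈ Finset.range N, frobPow (p ^ i) (I ^ (k / p ^ i % p)) := by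
  induction N with
  | zero => simp [Nat.mod_one]
  | succ N ih =>
    rw [Nat.mod_pow_succ, pow_add, Finset.prod_range_succ, mul_comm (p ^ N), pow_mul]
    exact Ideal.mul_mem_mul ih (pow_mem_frobPow (Ideal.pow_mem_pow hx _))

theorem pow_mem_intFrobPow {p : ℕ} (hp : 1 < p) {I : Ideal R} {x : R} (hx : x ∈ I) (k : ℕ) :
    x ^ k ∈ intFrobPow p k I := by
  have h := pow_mod_mem_prod p hx k (k + 1)
  rwa [Nat.mod_eq_of_lt ((Nat.lt_succ_self k).trans (Nat.lt_pow_self hp))] at h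

theorem intFrobPow_pow_le {p : ℕ} (hp : 1 < p) (e : ℕ) (I : Ideal R) :
    intFrobPow p (p ^ e) I ≤ frobPow (p ^ e) I := by
  have hmem : e ∈ Finset.range (p ^ e + 1) :=
    Finset.mem_range.mpr ((Nat.lt_pow_self hp).trans (Nat.lt_succ_self _))
  rw [intFrobPow, ← Finset.mul_prod_erase _ _ hmem, Nat.div_self (by positivity),
    Nat.mod_eq_of_lt hp, pow_one]
  exact Ideal.mul_le_left

theorem frobPow_le_intFrobPow {p : ℕ} (hp : 1 < p) {k q : ℕ} (hkq : k ≤ q) (I : Ideal R) :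
    frobPow q I ≤ intFrobPow p k I := by
  rw [frobPow, Ideal.span_le]
  rintro _ ⟨x, hx, rfl⟩
  rw [SetLike.mem_coe, ← Nat.sub_add_cancel hkq, pow_add]
  exact Ideal.mul_mem_left _ _ (pow_mem_intFrobPow hp hx k)

/-- Frobenius induces the identity on the spectrum. -/
theorem iterateFrobenius_faithfullyFlat {p : ℕ} [hp : Fact p.Prime] [CharP R p] {e : ℕ}
    (hF : (iterateFrobenius R p e).Flat) : (iterateFrobenius R p e).FaithfullyFlat := by
  refine RingHom.FaithfullyFlat.iff_flat_and_comap_surjective.mpr ⟨hF, fun P ↦ ⟨P, ?_⟩⟩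
  ext a
  change iterateFrobenius R p e a ∈ P.asIdeal ↔ _
  rw [iterateFrobenius_def]
  exact ⟨P.isPrime.mem_of_pow_mem _,
    fun h ↦ P.asIdeal.pow_mem_of_mem h _ (pow_pos hp.out.pos e)⟩

theorem le_frobRoot_intFrobPow {p : ℕ} [hp : Fact p.Prime] [CharP R p] {e k : ℕ}
    (hF : (iterateFrobenius R p e).Flat) (hk : k ≤ p ^ e) (I : Ideal R) :
    I ≤ frobRoot (p ^ e) (intFrobPow p k I) := by
  refine le_sInf fun c hc ↦ (iterateFrobenius_faithfullyFlat hF).le_of_map_le_map ?_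
  rw [← frobPow_pow_eq_map, ← frobPow_pow_eq_map]
  exact (frobPow_le_intFrobPow hp.out.one_lt hk I).trans hc

/-! ### Powers of the generic linear combination. -/

section GenericCombination

variable {m : ℕ} (g : Fin m → R)

theorem genericCombination_mem :
    genericCombination g ∈ (Ideal.span (Set.range g)).map (C : R →+* MvPolynomial (Fin m) R) :=
  sum_mem fun i _ ↦ Ideal.mul_mem_left _ _
    (Ideal.mem_map_of_mem _ (Ideal.subset_span (Set.mem_range_self i)))

theorem coeff_genericCombination_pow (u : Fin m →₀ ℕ) (k : ℕ) :
    coeff u (genericCombination g ^ k) =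
      if u.sum (fun _ e ↦ e) = k then u.multinomial * u.prod (fun i e ↦ g i ^ e) else 0 := by
  rw [← coeff_linearCombination_X_pow_of_fintype g u k, genericCombination]
  simp only [smul_eq_C_mul, mul_comm]

theorem totalDegree_genericCombination_pow_le (k : ℕ) :
    (genericCombination g ^ k).totalDegree ≤ k := by
  refine Finset.sup_le fun u hu ↦ ?_
  rw [mem_support_iff, coeff_genericCombination_pow] at hu
  by_contra h
  exact hu (if_neg fun h' ↦ h h'.le)

theorem isUnit_multinomial {p : ℕ} [hp : Fact p.Prime] [CharP R p] {σ : Type*} (u : σ →₀ ℕ)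
    (hu : u.sum (fun _ e ↦ e) < p) : IsUnit (u.multinomial : R) := by
  have hcop : Nat.Coprime u.multinomial p := by
    refine (hp.out.coprime_iff_not_dvd.mpr fun h ↦ ?_).symm
    have hspec := Nat.multinomial_spec u.support u
    have hd : p ∣ (∑ i ∈ u.support, u i).factorial :=
      hspec ▸ Dvd.dvd.mul_left h _
    exact absurd ((hp.out.dvd_factorial).mp hd) (not_le.mpr hu)
  have h := (ZMod.isUnit_iff_coprime u.multinomial p).mpr hcop
  have := h.map (ZMod.castHom dvd_rfl R)
  rwa [map_natCast] at this

/-- The single-digit case: each monomial of degree `k` in the `g i` is, up to a unit multinomial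
coefficient, a coefficient of `G ^ k`. -/
theorem span_pow_le_coeffIdeal (p : ℕ) [Fact p.Prime] [CharP R p] {k : ℕ} (hk : k < p) :
    Ideal.span (Set.range g) ^ k ≤ coeffIdeal (genericCombination g ^ k) := by
  intro y hy
  obtain ⟨P, hP, rfl⟩ := (Ideal.mem_span_pow_iff_exists_isHomogeneous g y).mp hy
  rw [eval_eq]
  refine sum_mem fun u hu ↦ Ideal.mul_mem_left _ _ ?_
  have hdeg : u.sum (fun _ e ↦ e) = k := by
    rw [← hP (mem_support_iff.mp hu), Finsupp.weight_apply]
    simp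
  have h := coeff_mem_coeffIdeal (genericCombination g ^ k) u
  rw [coeff_genericCombination_pow, if_pos hdeg] at h
  exact (Ideal.unit_mul_mem_iff_mem _ (isUnit_multinomial (p := p) u (hdeg ▸ hk))).mp h

theorem prod_le_coeffIdeal (p : ℕ) [hp : Fact p.Prime] [CharP R p] (k N : ℕ) :
    ∏ i ∈ Finset.range N, frobPow (p ^ i) (Ideal.span (Set.range g) ^ (k / p ^ i % p)) ≤
      coeffIdeal (genericCombination g ^ (k % p ^ N)) := by
  induction N with
  | zero =>
    have h := coeff_mem_coeffIdeal (1 : MvPolynomial (Fin m) R) 0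
    rw [coeff_zero_one] at h
    rw [pow_zero, Nat.mod_one, pow_zero, (Ideal.eq_top_iff_one _).mpr h]
    exact le_top
  | succ N ih =>
    rw [Nat.mod_pow_succ, pow_add, Finset.prod_range_succ, mul_comm (p ^ N), pow_mul,
      frobPow_pow_eq_map]
    refine (Ideal.mul_mono ih (Ideal.map_mono (span_pow_le_coeffIdeal g p
      (Nat.mod_lt _ hp.out.pos)))).trans (coeffIdeal_mul_map_le N ?_ _)
    exact (totalDegree_genericCombination_pow_le g _).trans_lt
      (Nat.mod_lt _ (pow_pos hp.out.pos N))

/-- The integral Frobenius power of `(g₁, …, g_m)` is contained in the ideal of coefficients of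
the corresponding power of the generic linear combination. -/
theorem intFrobPow_le_coeffIdeal (p : ℕ) [hp : Fact p.Prime] [CharP R p] (k : ℕ) :
    intFrobPow p k (Ideal.span (Set.range g)) ≤ coeffIdeal (genericCombination g ^ k) := by
  have h := prod_le_coeffIdeal g p k (k + 1)
  rwa [Nat.mod_eq_of_lt ((Nat.lt_succ_self k).trans (Nat.lt_pow_self hp.out.one_lt))] at h

theorem frobRoot_genericCombination_le (p : ℕ) [hp : Fact p.Prime] [CharP R p] (e k : ℕ) :
    frobRoot (p ^ e) (Ideal.span {genericCombination g} ^ k) ≤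
      (ratFrobPow p k e (Ideal.span (Set.range g))).map
        (C : R →+* MvPolynomial (Fin m) R) := by
  intro f hf
  rw [mem_map_C_iff]
  intro u
  rw [ratFrobPow, frobRoot, Submodule.mem_sInf]
  intro c hc
  -- Membership in an extended ideal is tested on coefficients, so extension passes through the
  -- infimum over `c`.
  refine mem_map_C_iff.mp (frobRoot_le ?_ hf) u
  rw [Ideal.span_singleton_pow, Ideal.span_singleton_le_iff_mem]
  refine map_frobPow_le C _ _ (Ideal.map_mono hc ?_)
  rw [map_intFrobPow]
  exact pow_mem_intFrobPow hp.out.one_lt (genericCombination_mem g) k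

theorem map_ratFrobPow_le (p : ℕ) [hp : Fact p.Prime] [CharP R p] {e k : ℕ}
    (hF : (iterateFrobenius R p e).Flat) (hk : k < p ^ e) :
    (ratFrobPow p k e (Ideal.span (Set.range g))).map (C : R →+* MvPolynomial (Fin m) R) ≤
      frobRoot (p ^ e) (Ideal.span {genericCombination g} ^ k) := by
  refine le_sInf fun J hJ ↦ Ideal.map_le_iff_le_comap.mpr (frobRoot_le ?_)
  refine (intFrobPow_le_coeffIdeal g p k).trans ?_
  rw [coeffIdeal, Ideal.span_le]
  rintro _ ⟨u, rfl⟩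
  rw [Set.mem_ofPred_eq, Ideal.span_singleton_pow, Ideal.span_singleton_le_iff_mem,
    frobPow_pow_eq_map] at hJ
  rw [SetLike.mem_coe, frobPow_pow_eq_map]
  exact hF.mem_map_comap_C J (C_coeff_mem_of_mem_map_iterateFrobenius e
    ((totalDegree_genericCombination_pow_le g k).trans_lt hk) hJ u)

end GenericCombination

end GenFrob

theorem mainTheorem1 {R : Type*} [CommRing R] [IsDomain R] [IsRegularRing R]
    (p : ℕ) [Fact p.Prime] [CharP R p] (hF : (frobenius R p).Finite)
    (m : ℕ) (g : Fin m → R) (a : Ideal R) (ha : a = Ideal.span (Set.range g))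
    (t : ℝ) (ht0 : 0 < t) (ht1 : t < 1) :
    GenFrob.testIdeal p t (Ideal.span {GenFrob.genericCombination g}) =
        Ideal.map (MvPolynomial.C : R →+* MvPolynomial (Fin m) R) (GenFrob.realFrobPow p t a) ∧
      GenFrob.realFrobPow p t a =
        Ideal.comap (MvPolynomial.C : R →+* MvPolynomial (Fin m) R)
          (GenFrob.testIdeal p t (Ideal.span {GenFrob.genericCombination g})) := by
  subst ha
  have hp : p.Prime := Fact.out
  have hflat := IsRegularRing.iterateFrobenius_flat R p hF
  have hceil (e : ℕ) : ⌈(p : ℝ) ^ e * t⌉₊ ≤ p ^ e := by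
    rw [Nat.ceil_le, Nat.cast_pow]
    exact mul_le_of_le_one_right (by positivity) ht1.le
  -- If `p^e (1 - t) > 1`, then `⌈p^e t⌉ < p^e t + 1 < p^e`.
  have hlt : ∃ e : ℕ, ⌈(p : ℝ) ^ e * t⌉₊ < p ^ e := by
    obtain ⟨e, he⟩ := pow_unbounded_of_one_lt (1 / (1 - t))
      (show (1 : ℝ) < p by exact_mod_cast hp.one_lt)
    rw [div_lt_iff₀ (by linarith)] at he
    refine ⟨e, ?_⟩
    have h := Nat.ceil_lt_add_one (show 0 ≤ (p : ℝ) ^ e * t by positivity)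
    have : ((⌈(p : ℝ) ^ e * t⌉₊ : ℕ) : ℝ) < ((p ^ e : ℕ) : ℝ) := by
      rw [Nat.cast_pow]
      linarith
    exact_mod_cast this
  have h1 : GenFrob.testIdeal p t (Ideal.span {GenFrob.genericCombination g}) =
      Ideal.map (MvPolynomial.C : R →+* MvPolynomial (Fin m) R)
        (GenFrob.realFrobPow p t (Ideal.span (Set.range g))) := by
    rw [GenFrob.testIdeal, GenFrob.realFrobPow, Ideal.map_iSup]
    refine le_antisymm (iSup_mono fun e ↦ GenFrob.frobRoot_genericCombination_le g p e _)
      (iSup_le fun e ↦ ?_)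
    rcases (hceil e).lt_or_eq with h | h
    · exact (GenFrob.map_ratFrobPow_le g p (hflat e) h).trans (le_iSup_of_le e le_rfl)
    -- Equality does occur, for instance at `e = 0`. Such a term lies in `a`, which lies in the term
    -- of any `e'` with strict inequality.
    · obtain ⟨e', he'⟩ := hlt
      refine le_trans (Ideal.map_mono ?_)
        ((GenFrob.map_ratFrobPow_le g p (hflat e') he').trans (le_iSup_of_le e' le_rfl))
      rw [GenFrob.ratFrobPow, h]
      exact (GenFrob.frobRoot_le (GenFrob.intFrobPow_pow_le hp.one_lt e _)).trans
        (GenFrob.le_frobRoot_intFrobPow (hflat e') he'.le _)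
  refine ⟨h1, ?_⟩
  rw [h1]
  ext r
  rw [Ideal.mem_comap, MvPolynomial.mem_map_C_iff]
  classical
  refine ⟨fun hr u ↦ ?_, fun h ↦ by simpa using h 0⟩
  rw [MvPolynomial.coeff_C]
  split_ifs
  · exact hr
  · exact zero_mem _
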